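/- A network on a finite set of $n$ buses is a connected simple graph in which every line $i\sim k$ has an admittance $y_{ik}=y_{ki}=g_{ik}+\mathrm{j}b_{ik}\neq 0$ with $g_{ik}\ge 0$ and $b_{ik}\le 0$, and every bus $i$ has a shunt admittance $y_{ii}\in\mathbb C$. Its admittance matrix $\mathbf Y\in\mathbb C^{n\times n}$ has entries $Y_{ii}=\sum_{l\sim i}y_{il}+y_{ii}$, $Y_{ik}=-y_{ik}$ if $i\sim k$, and $Y_{ik}=0$ if $i\ne k$ and $i\not\sim k$. A line is lossless if $g_{ik}=0$; a lossless cycle is a network whose graph is a cycle (of length at least 3) and all of whose lines are lossless; a tree is a network whose graph is a tree. A network $K$ is a 1-connection of networks $G$ and $H$ if $K$ is the union of a copy of $G$ and a copy of $H$ that have exactly one bus in common and no lines between them; line admittances and the shunts at the other buses are unchanged, and the shunts of $G$ and $H$ at the common bus add up (so that $\mathbf Y_K$ is the sum of $\mathbf Y_G$ and $\mathbf Y_H$, extended by zeros). (a) Let a network be obtained from lossless cycles and trees by repeated 1-connections, and let $0\le\underline V_i\le\overline V_i$ be real voltage bounds at its buses. Put $$\mathcal P=\{\operatorname{Re}(\operatorname{diag}(\mathbf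 v\mathbf v^H\mathbf Y^H)) : \mathbf v\in\mathbb C^n,\ \underline V_i\le|v_i|\le\overline V_i\ \text{for all } i\},$$ $$\tilde{\mathcal P}=\{\operatorname{Re}(\operatorname{diag}(\mathbf W\mathbf Y^H)) : \mathbf W\in\mathbb C^{n\times n}\ \text{Hermitian positive semidefinite},\ \underline V_i^2\le W_{ii}\le\overline V_i^2\ \text{for all } i\}.$$ Then $\operatorname{conv}(\mathcal P)=\tilde{\mathcal P}$. (b) Say that a matrix $\mathbf A\in\mathbb C^{n\times n}$ satisfies a network on $n$ buses if for all $i\neq k$ one has $A_{ik}=0$ if and only if $i\not\sim k$, and $A_{ik}$ is purely imaginary whenever the line between $i$ and $k$ is lossless. Say that a network on $n$ buses has the rank bound if every Hermitian positive semidefinite matrix that satisfies it has rank at least $n-1$. If two networks $G$ and $H$ (arbitrary, not only those in (a)) have the rank bound, then so does every 1-connection $K$ of $G$ and $H$ (that is, if $G$ has $n$ buses and $H$ has $m$ buses, every Hermitian positive semidefinite matrix that satisfies $K$ has rank at least $n+m-2$). -/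

import Mathlib

open scoped Matrix ComplexOrder

universe u

/-- A (connected) electric network on the set of buses `V`. -/
structure Network (V : Type u) where
  /-- the lines: `graph.Adj i k` means that bus `i` is connected to bus `k` -/
  graph : SimpleGraph V
  /-- `y i k` is the admittance of the line between `i` and `k`
  (it is only used when there is such a line) -/
  y : V → V → ℂ
  /-- the shunt admittance of each bus to ground -/
  shunt : V → ℂ
  connected : graph.Connected
  y_symm : ∀ i k, y i k = y k i
  y_ne_zero : ∀ i k, graph.Adj i k → y i k ≠ 0
  conductance_nonneg : ∀ i k, graph.Adj i k → 0 ≤ (y i k).re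
  susceptance_nonpos : ∀ i k, graph.Adj i k → (y i k).im ≤ 0

namespace Network

/-- The bus admittance matrix. -/
noncomputable def admittance {V : Type u} [Fintype V] (N : Network V) : Matrix V V ℂ :=
  open Classical in
  Matrix.of fun i k =>
    if i = k then (∑ l with N.graph.Adj i l, N.y i l) + N.shunt i
    else if N.graph.Adj i k then -N.y i k
    else 0

/-- The real powers `Re (diag (W Yᴴ))` associated with a matrix `W`. -/
noncomputable def realPower {V : Type u} [Fintype V] (N : Network V) (W : Matrix V V ℂ) : V → ℝ :=
  fun i => ((W * N.admittanceᴴ) i i).re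

/-- The voltage constrained injection region: the real power vectors `Re (diag (v vᴴ Yᴴ))` of
the bus voltage vectors `v` whose magnitudes lie between the bounds. -/
def injectionRegion {V : Type u} [Fintype V] (N : Network V) (Vlo Vhi : V → ℝ) : Set (V → ℝ) :=
  {p | ∃ v : V → ℂ, (∀ i, Vlo i ≤ ‖v i‖ ∧ ‖v i‖ ≤ Vhi i) ∧
    p = N.realPower (Matrix.vecMulVec v (star v))}

/-- The enlarged region obtained by replacing `v vᴴ` by any positive semidefinite matrix. -/
def relaxedRegion {V : Type u} [Fintype V] (N : Network V) (Vlo Vhi : V → ℝ) : Set (V → ℝ) :=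
  {p | ∃ W : Matrix V V ℂ, W.PosSemidef ∧
    (∀ i, Vlo i ^ 2 ≤ (W i i).re ∧ (W i i).re ≤ Vhi i ^ 2) ∧ p = N.realPower W}

/-- The line between `i` and `k` exists and is lossless. -/
def IsLosslessLine {V : Type u} (N : Network V) (i k : V) : Prop :=
  N.graph.Adj i k ∧ (N.y i k).re = 0

/-- The network is a tree (with arbitrary line admittances). -/
def IsTree {V : Type u} (N : Network V) : Prop :=
  N.graph.IsTree

/-- The network is a cycle all of whose lines are lossless. -/
def IsLosslessCycle {V : Type u} (N : Network V) : Prop :=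
  (∃ n : ℕ, 3 ≤ n ∧ Nonempty (N.graph ≃g SimpleGraph.cycleGraph n)) ∧
    ∀ i k, N.graph.Adj i k → N.IsLosslessLine i k

/-- `K` is a 1-connection of `G` and `H`: it is the union of a copy of `G` and a copy of `H` that
have exactly one bus in common, with no lines between them.  Lines keep their admittances, and the
shunts of the two copies of the common bus are in parallel, so that the admittance matrix of `K`
is the sum of the admittance matrices of its two parts (extended by zero). -/
def IsOneConnection {U V W : Type u} (G : Network U) (H : Network V) (K : Network W) : Prop :=
  ∃ (φ : U ↪ W) (ψ : V ↪ W) (a : U) (b : V),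
    -- every bus of `K` belongs to one of the two parts, and they share exactly one bus
    (∀ w, w ∈ Set.range φ ∨ w ∈ Set.range ψ) ∧
    (∀ i j, φ i = ψ j ↔ i = a ∧ j = b) ∧
    -- the two parts are equal to `G` and `H`
    (∀ i k, K.graph.Adj (φ i) (φ k) ↔ G.graph.Adj i k) ∧
    (∀ j l, K.graph.Adj (ψ j) (ψ l) ↔ H.graph.Adj j l) ∧
    (∀ i k, G.graph.Adj i k → K.y (φ i) (φ k) = G.y i k) ∧
    (∀ j l, H.graph.Adj j l → K.y (ψ j) (ψ l) = H.y j l) ∧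
    (∀ i, i ≠ a → K.shunt (φ i) = G.shunt i) ∧
    (∀ j, j ≠ b → K.shunt (ψ j) = H.shunt j) ∧
    K.shunt (φ a) = G.shunt a + H.shunt b ∧
    -- there are no lines between them
    (∀ i j, i ≠ a → j ≠ b → ¬ K.graph.Adj (φ i) (ψ j))

/-- The networks obtained by repeatedly 1-connecting lossless cycles and trees. -/
inductive IsCycleTreeConnection : {V : Type u} → Network V → Prop
  | tree {V : Type u} (N : Network V) : N.IsTree → IsCycleTreeConnection N
  | cycle {V : Type u} (N : Network V) : N.IsLosslessCycle → IsCycleTreeConnection N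
  | connect {U V W : Type u} (G : Network U) (H : Network V) (K : Network W) :
      IsCycleTreeConnection G → IsCycleTreeConnection H → IsOneConnection G H K →
      IsCycleTreeConnection K

/-- The matrix `A` satisfies the network: its off-diagonal entries vanish exactly at the pairs of
buses without a line, and are purely imaginary at the lossless lines. -/
def IsSatisfiedBy {V : Type u} (N : Network V) (A : Matrix V V ℂ) : Prop :=
  (∀ i k, i ≠ k → (A i k = 0 ↔ ¬ N.graph.Adj i k)) ∧
    ∀ i k, N.IsLosslessLine i k → (A i k).re = 0

/-- Every positive semidefinite matrix that satisfies the network has rank at least the number of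
buses minus one. -/
def HasRankBound {V : Type u} [Fintype V] (N : Network V) : Prop :=
  ∀ A : Matrix V V ℂ, A.PosSemidef → N.IsSatisfiedBy A → Fintype.card V ≤ A.rank + 1

end Network

open Module in
theorem Matrix.rank_gram_eq_finrank_span {n ι : Type*} [Fintype n] [Fintype ι]
    (v : n → EuclideanSpace ℂ ι) :
    (Matrix.gram ℂ v).rank = finrank ℂ (Submodule.span ℂ (Set.range v)) := by
  have h : Matrix.gram ℂ v = (Matrix.of fun s j => v j s)ᴴ * Matrix.of fun s j => v j s := by
    ext i j
    simp [Matrix.mul_apply, PiLp.inner_apply, mul_comm]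
  rw [h, Matrix.rank_conjTranspose_mul_self, Matrix.rank_eq_finrank_span_cols]
  have := (WithLp.linearEquiv 2 ℂ (ι → ℂ)).finrank_map_eq (Submodule.span ℂ (Set.range v))
  rw [← this, Submodule.map_span, ← Set.range_comp]
  rfl

theorem Matrix.PosSemidef.exists_eq_gram {n : Type*} [Fintype n] {A : Matrix n n ℂ}
    (hA : A.PosSemidef) : ∃ (m : ℕ) (v : n → EuclideanSpace ℂ (Fin m)), A = Matrix.gram ℂ v := by
  obtain ⟨m, b, rfl⟩ := Matrix.posSemidef_iff_eq_sum_vecMulVec.mp hA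
  refine ⟨m, fun j => WithLp.toLp 2 fun s => star (b s j), ?_⟩
  ext i j
  simp [Matrix.sum_apply, Matrix.vecMulVec_apply, PiLp.inner_apply, mul_comm]

open Module in
theorem finrank_span_add_finrank_span_le {E U V W : Type*} [NormedAddCommGroup E]
    [InnerProductSpace ℂ E] [FiniteDimensional ℂ E] (S : Submodule ℂ E) (b : W → E)
    (φ : U → W) (ψ : V → W) (hS : S ≤ Submodule.span ℂ (Set.range b)) :
    finrank ℂ (Submodule.span ℂ (Set.range fun i => S.starProjection (b (φ i)))) +
      finrank ℂ (Submodule.span ℂ (Set.range fun j => b (ψ j) - S.starProjection (b (ψ j)))) ≤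
      finrank ℂ (Submodule.span ℂ (Set.range b)) := by
  set P := Submodule.span ℂ (Set.range fun i => S.starProjection (b (φ i)))
  set Q := Submodule.span ℂ (Set.range fun j => b (ψ j) - S.starProjection (b (ψ j)))
  have hP : P ≤ S := Submodule.span_le.mpr <| by
    rintro _ ⟨i, rfl⟩
    exact Submodule.starProjection_apply_mem S _
  have hQ : Q ≤ Sᗮ := Submodule.span_le.mpr <| by
    rintro _ ⟨j, rfl⟩
    exact Submodule.sub_starProjection_mem_orthogonal _
  have hd : Disjoint P Q := (Submodule.orthogonal_disjoint S).mono hP hQ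
  have hQ' : Q ≤ Submodule.span ℂ (Set.range b) := Submodule.span_le.mpr <| by
    rintro _ ⟨j, rfl⟩
    exact Submodule.sub_mem _ (Submodule.subset_span ⟨_, rfl⟩)
      (hS (Submodule.starProjection_apply_mem S _))
  rw [← Submodule.finrank_sup_add_finrank_inf_eq, hd.eq_bot, finrank_bot, add_zero]
  exact Submodule.finrank_mono (sup_le (hP.trans hS) hQ')

theorem card_add_card_eq_card_add_one {U V W : Type*} [Fintype U] [Fintype V] [Fintype W]
    (φ : U ↪ W) (ψ : V ↪ W) {a : U} {b : V} (hcov : ∀ w, w ∈ Set.range φ ∨ w ∈ Set.range ψ)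
    (hab : ∀ i j, φ i = ψ j ↔ i = a ∧ j = b) :
    Fintype.card U + Fintype.card V = Fintype.card W + 1 := by
  classical
  have h := Finset.card_union_add_card_inter (Finset.univ.map φ) (Finset.univ.map ψ)
  have h1 : Finset.univ.map φ ∪ Finset.univ.map ψ = Finset.univ := by
    ext w
    simpa using hcov w
  have h2 : Finset.univ.map φ ∩ Finset.univ.map ψ = {φ a} := by
    ext w
    simp only [Finset.mem_inter, Finset.mem_map, Finset.mem_univ, true_and, Finset.mem_singleton]
    constructor
    · rintro ⟨⟨i, rfl⟩, j, hj⟩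
      rw [((hab i j).mp hj.symm).1]
    · rintro rfl
      exact ⟨⟨a, rfl⟩, b, ((hab a b).mpr ⟨rfl, rfl⟩).symm⟩
  rw [h1, h2] at h
  simpa using h.symm

namespace Network

theorem HasRankBound.oneConnection {U V W : Type u} [Fintype U] [Fintype V] [Fintype W]
    {G : Network U} {H : Network V} {K : Network W} (hK : IsOneConnection G H K)
    (hG : G.HasRankBound) (hH : H.HasRankBound) : K.HasRankBound := by
  obtain ⟨φ, ψ, a, b, hcov, hab, hAG, hAH, hyG, hyH, -, -, -, hno⟩ := hK
  intro A hA hsat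
  obtain ⟨m, v, rfl⟩ := hA.exists_eq_gram
  set S := Submodule.span ℂ (Set.range fun i : {i // i ≠ a} => v (φ i)) with hSdef
  have memS : ∀ i, i ≠ a → v (φ i) ∈ S := fun i hi => Submodule.subset_span ⟨⟨i, hi⟩, rfl⟩
  have projS : ∀ i, i ≠ a → S.starProjection (v (φ i)) = v (φ i) := fun i hi =>
    Submodule.starProjection_eq_self_iff.mpr (memS i hi)
  have projT : ∀ j, j ≠ b → S.starProjection (v (ψ j)) = 0 := by
    intro j hj
    refine (Submodule.starProjection_apply_eq_zero_iff S).mpr ?_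
    rw [Submodule.mem_orthogonal]
    intro x hx
    induction hx using Submodule.span_induction with
    | mem x hx =>
      obtain ⟨⟨i, hi⟩, rfl⟩ := hx
      exact (hsat.1 _ _ fun h => hi ((hab i j).mp h).1).mpr (hno i j hi hj)
    | zero => simp
    | add x y _ _ hx hy => rw [inner_add_left, hx, hy, add_zero]
    | smul c x _ hx => rw [inner_smul_left, hx, mul_zero]
  have hGe : ∀ i k, i ≠ k → Matrix.gram ℂ (fun i => S.starProjection (v (φ i))) i k =
      Matrix.gram ℂ v (φ i) (φ k) := by
    intro i k hik
    simp only [Matrix.gram_apply]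
    rcases eq_or_ne i a with rfl | hi
    · rw [projS k hik.symm, Submodule.inner_starProjection_left_eq_right, projS k hik.symm]
    · rw [projS i hi, ← Submodule.inner_starProjection_left_eq_right, projS i hi]
  have hHe : ∀ j l, j ≠ l →
      Matrix.gram ℂ (fun j => v (ψ j) - S.starProjection (v (ψ j))) j l =
        Matrix.gram ℂ v (ψ j) (ψ l) := by
    intro j l hjl
    simp only [Matrix.gram_apply]
    rcases eq_or_ne j b with rfl | hj
    · rw [projT l hjl.symm, sub_zero, inner_sub_left,
        Submodule.inner_starProjection_left_eq_right, projT l hjl.symm, inner_zero_right, sub_zero]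
    · rw [projT j hj, sub_zero, inner_sub_right,
        ← Submodule.inner_starProjection_left_eq_right, projT j hj, inner_zero_left, sub_zero]
  have rG := hG _ (Matrix.posSemidef_gram ℂ fun i => S.starProjection (v (φ i)))
    ⟨fun i k hik => by rw [hGe i k hik, hsat.1 _ _ (φ.injective.ne hik), hAG],
      fun i k h => by
        rw [hGe i k h.1.ne]
        exact hsat.2 _ _ ⟨(hAG i k).mpr h.1, by rw [hyG i k h.1, h.2]⟩⟩
  have rH := hH _ (Matrix.posSemidef_gram ℂ fun j => v (ψ j) - S.starProjection (v (ψ j)))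
    ⟨fun i k hik => by rw [hHe i k hik, hsat.1 _ _ (ψ.injective.ne hik), hAH],
      fun i k h => by
        rw [hHe i k h.1.ne]
        exact hsat.2 _ _ ⟨(hAH i k).mpr h.1, by rw [hyH i k h.1, h.2]⟩⟩
  rw [Matrix.rank_gram_eq_finrank_span] at rG rH ⊢
  have hle := finrank_span_add_finrank_span_le S v φ ψ <| Submodule.span_le.mpr <| by
    rintro _ ⟨i, rfl⟩
    exact Submodule.subset_span ⟨_, rfl⟩
  have hcard := card_add_card_eq_card_add_one φ ψ hcov hab
  omega

end Network

open Module in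
/-- In a finite-dimensional space, the convex hull of a compact set is compact. -/
theorem IsCompact.convexHull_of_finiteDimensional {E : Type*} [NormedAddCommGroup E]
    [NormedSpace ℝ E] [FiniteDimensional ℝ E] {s : Set E} (hs : IsCompact s) :
    IsCompact (convexHull ℝ s) := by
  rcases s.eq_empty_or_nonempty with rfl | ⟨x₀, hx₀⟩
  · simp
  set N := finrank ℝ E + 1
  have hcont : Continuous fun p : (Fin N → ℝ) × (Fin N → E) => ∑ i, p.1 i • p.2 i := by fun_prop
  have hcomp : IsCompact (stdSimplex ℝ (Fin N) ×ˢ Set.univ.pi fun _ : Fin N => s) :=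
    (isCompact_stdSimplex ℝ (Fin N)).prod (isCompact_univ_pi fun _ => hs)
  convert hcomp.image hcont
  apply Set.Subset.antisymm
  · intro x hx
    obtain ⟨ι, _, z, w, hz, haff, hw, hw1, hsum⟩ := eq_pos_convex_span_of_mem_convexHull hx
    have hcard : Fintype.card ι ≤ Fintype.card (Fin N) := by
      rw [Fintype.card_fin]
      exact haff.card_le_finrank_succ.trans
        (Nat.add_le_add_right (Submodule.finrank_le _) 1)
    obtain ⟨e⟩ := Function.Embedding.nonempty_of_card_le hcard
    have hout : ∀ k, k ∉ Set.range e → Function.extend e w 0 k = 0 := fun k hk => by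
      rw [Function.extend_apply' _ _ _ (by simpa using hk)]; rfl
    refine ⟨(Function.extend e w 0, Function.extend e z fun _ => x₀), ⟨⟨fun k => ?_, ?_⟩, ?_⟩, ?_⟩
    · change 0 ≤ Function.extend e w 0 k
      by_cases hk : k ∈ Set.range e
      · obtain ⟨i, rfl⟩ := hk
        rw [e.injective.extend_apply]
        exact (hw i).le
      · rw [hout k hk]
    · rw [← hw1]
      refine (Fintype.sum_of_injective e e.injective _ _ hout fun i => ?_).symm
      rw [e.injective.extend_apply]
    · intro k _
      by_cases hk : k ∈ Set.range e
      · obtain ⟨i, rfl⟩ := hk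
        simp only [e.injective.extend_apply]
        exact hz ⟨i, rfl⟩
      · simp only [Function.extend_apply' _ _ _ (show ¬ ∃ i, e i = k by simpa using hk)]
        exact hx₀
    · rw [← hsum]
      refine (Fintype.sum_of_injective e e.injective _ _ (fun k hk => ?_) fun i => ?_).symm
      · simp only [hout k hk, zero_smul]
      · simp only [e.injective.extend_apply]
  · rintro _ ⟨⟨w, z⟩, ⟨⟨hw0, hw1⟩, hz⟩, rfl⟩
    exact (convex_convexHull ℝ s).sum_mem (fun i _ => hw0 i) hw1
      fun i _ => subset_convexHull ℝ s (hz i trivial)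

/-- `a` is a best choice of the phases of the numbers `a i` among all those with the same sum of
phases. -/
def IsPhaseMax {ι : Type*} [Fintype ι] (a : ι → ℂ) : Prop :=
  ∀ (δ : ι → ℝ) (k : ℤ), ∑ i, δ i = k * (2 * Real.pi) →
    ∑ i, (a i * Complex.exp (δ i * Complex.I)).re ≤ ∑ i, (a i).re

namespace IsPhaseMax

variable {ι : Type*} [Fintype ι] {a : ι → ℂ}

theorem re_mul_exp (z : ℂ) (t : ℝ) :
    (z * Complex.exp (t * Complex.I)).re = z.re * Real.cos t - z.im * Real.sin t := by
  rw [Complex.mul_re, Complex.exp_ofReal_mul_I_re, Complex.exp_ofReal_mul_I_im]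

theorem sum_le (ha : IsPhaseMax a) {δ : ι → ℝ} (hδ : ∑ i, δ i = 0) (t : ℝ) :
    ∑ i, ((a i).re * Real.cos (t * δ i) - (a i).im * Real.sin (t * δ i)) ≤ ∑ i, (a i).re := by
  have h := ha (fun i => t * δ i) 0 (by rw [← Finset.mul_sum, hδ]; simp)
  simpa only [re_mul_exp] using h

theorem sum_mul_im_eq_zero (ha : IsPhaseMax a) {δ : ι → ℝ} (hδ : ∑ i, δ i = 0) :
    ∑ i, (a i).im * δ i = 0 := by
  have hd : HasDerivAt
      (fun t : ℝ => ∑ i, ((a i).re * Real.cos (t * δ i) - (a i).im * Real.sin (t * δ i)))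
      (∑ i, ((a i).re * (-Real.sin (0 * δ i) * δ i) - (a i).im * (Real.cos (0 * δ i) * δ i))) 0 := by
    refine HasDerivAt.fun_sum fun i _ => ?_
    have h1 : HasDerivAt (fun t : ℝ => t * δ i) (δ i) 0 := by
      simpa using (hasDerivAt_id (0 : ℝ)).mul_const (δ i)
    exact (h1.cos.const_mul _).sub (h1.sin.const_mul _)
  have hm : IsLocalMax
      (fun t : ℝ => ∑ i, ((a i).re * Real.cos (t * δ i) - (a i).im * Real.sin (t * δ i))) 0 :=
    Filter.Eventually.of_forall fun t => by
      simpa using ha.sum_le hδ t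
  have := hm.hasDerivAt_eq_zero hd
  simpa using this

theorem im_eq_im (ha : IsPhaseMax a) (i j : ι) : (a i).im = (a j).im := by
  classical
  have h := ha.sum_mul_im_eq_zero (δ := fun k => (if k = i then 1 else 0) - if k = j then 1 else 0)
    (by simp)
  simpa [mul_sub, sub_eq_zero] using h

theorem sum_re_mul_sq_nonneg (ha : IsPhaseMax a) {δ : ι → ℝ} (hδ : ∑ i, δ i = 0) :
    0 ≤ ∑ i, (a i).re * δ i ^ 2 := by
  have key : ∀ t : ℝ, 0 ≤ ∑ i, (a i).re * (t⁻¹ • (Real.sin ((0 + t) * δ i) - Real.sin (0 * δ i))) ^ 2 := by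
    intro t
    have h1 := ha.sum_le hδ (2 * t)
    have h2 := ha.sum_le hδ (-(2 * t))
    have h3 := add_le_add h1 h2
    rw [← Finset.sum_add_distrib, ← Finset.sum_add_distrib, ← sub_nonneg,
      ← Finset.sum_sub_distrib] at h3
    have : ∑ i, (a i).re * (t⁻¹ • (Real.sin ((0 + t) * δ i) - Real.sin (0 * δ i))) ^ 2 =
        t⁻¹ ^ 2 / 4 * ∑ i, ((a i).re + (a i).re - ((a i).re * Real.cos (2 * t * δ i) -
          (a i).im * Real.sin (2 * t * δ i) + ((a i).re * Real.cos (-(2 * t) * δ i) -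
          (a i).im * Real.sin (-(2 * t) * δ i)))) := by
      rw [Finset.mul_sum]
      refine Finset.sum_congr rfl fun i _ => ?_
      rw [neg_mul, Real.cos_neg, Real.sin_neg, mul_assoc, Real.cos_two_mul, Real.cos_sq']
      simp
      ring
    rw [this]
    positivity
  have hlim : Filter.Tendsto
      (fun t : ℝ => ∑ i, (a i).re * (t⁻¹ • (Real.sin ((0 + t) * δ i) - Real.sin (0 * δ i))) ^ 2)
      (nhdsWithin 0 {0}ᶜ) (nhds (∑ i, (a i).re * δ i ^ 2)) := by
    refine tendsto_finsetSum _ fun i _ => Filter.Tendsto.const_mul _ (Filter.Tendsto.pow ?_ 2)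
    have h1 : HasDerivAt (fun t : ℝ => Real.sin (t * δ i)) (δ i) 0 := by
      have h1 : HasDerivAt (fun t : ℝ => t * δ i) (δ i) 0 := by
        simpa using (hasDerivAt_id (0 : ℝ)).mul_const (δ i)
      simpa using h1.sin
    exact hasDerivAt_iff_tendsto_slope_zero.mp h1
  exact ge_of_tendsto hlim (Filter.Eventually.of_forall key)

theorem conj (ha : IsPhaseMax a) : IsPhaseMax fun i => star (a i) := by
  intro δ k hδ
  have h := ha (fun i => -δ i) (-k) (by rw [Finset.sum_neg_distrib, hδ]; push_cast; ring)
  simpa only [re_mul_exp, Real.cos_neg, Real.sin_neg, Complex.star_def, Complex.conj_re,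
    Complex.conj_im, mul_neg, neg_mul] using h

theorem sum_arg_le_pi (ha : IsPhaseMax a) (hpos : ∀ i, 0 < (a i).im) :
    ∑ i, (a i).arg ≤ Real.pi := by
  by_contra! hlt
  set Φ := ∑ i, (a i).arg with hΦ
  have hpi := Real.pi_pos
  have hΦ0 : 0 < Φ := hpi.trans hlt
  have hΦne : Φ ≠ 0 := hΦ0.ne'
  have h := ha (fun i => -(2 * Real.pi / Φ) * (a i).arg) (-1) (by
    rw [← Finset.mul_sum, ← hΦ]
    push_cast
    field_simp)
  refine absurd h (not_le.mpr ?_)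
  have hne : (Finset.univ : Finset ι).Nonempty := by
    by_contra hne
    rw [Finset.not_nonempty_iff_eq_empty] at hne
    rw [hΦ, hne, Finset.sum_empty] at hlt
    linarith
  refine Finset.sum_lt_sum_of_nonempty hne fun i _ => ?_
  set ε := (a i).arg with hε
  have hn : 0 < ‖a i‖ := norm_pos_iff.mpr fun h0 => by simpa [h0] using hpos i
  have hε0 : 0 < ε := by
    rcases (Complex.arg_nonneg_iff.mpr (hpos i).le).lt_or_eq with h0 | h0
    · exact h0
    · exact absurd (Complex.arg_eq_zero_iff.mp h0.symm).2 (hpos i).ne'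
  have hεpi : ε ≤ Real.pi := Complex.arg_le_pi _
  have ha' : a i = ‖a i‖ * Complex.exp (ε * Complex.I) := (Complex.norm_mul_exp_arg_mul_I _).symm
  have hre : (a i).re = ‖a i‖ * Real.cos ε := by
    rw [hε, Complex.norm_mul_cos_arg]
  have h2 : a i * Complex.exp ((-(2 * Real.pi / Φ) * ε : ℝ) * Complex.I) =
      (‖a i‖ : ℂ) * Complex.exp (((1 - 2 * Real.pi / Φ) * ε : ℝ) * Complex.I) := by
    conv_lhs => rw [ha']
    rw [mul_assoc, ← Complex.exp_add]
    congr 2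
    push_cast
    ring
  rw [h2, re_mul_exp, hre]
  simp only [Complex.ofReal_re, Complex.ofReal_im, zero_mul, sub_zero]
  refine mul_lt_mul_of_pos_left ?_ hn
  have hq0 : 0 < 2 * Real.pi / Φ := by positivity
  have hq2 : 2 * Real.pi / Φ < 2 := by
    rw [div_lt_iff₀ (by linarith)]
    linarith
  rw [← Real.cos_abs ((1 - _) * _)]
  refine Real.cos_lt_cos_of_nonneg_of_le_pi (abs_nonneg _) hεpi ?_
  rw [abs_mul, abs_of_pos hε0]
  have : |1 - 2 * Real.pi / Φ| < 1 := abs_lt.mpr ⟨by linarith, by linarith⟩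
  nlinarith

end IsPhaseMax

/-- A quadratic form attached to an edge of a polygon: `cot ε` times the squared length of the edge,
plus four times the oriented area of the triangle that it spans with the origin. -/
noncomputable def edgeForm (ε : ℝ) (u w : ℂ) : ℝ :=
  Real.cos ε / Real.sin ε * Complex.normSq (u - w) + 2 * (u * star w).im

theorem edgeForm_add_le {α ε : ℝ} (hα : 0 < α) (hε : 0 < ε) (h : α + ε < Real.pi) (u m w : ℂ) :
    edgeForm (α + ε) u w ≤ edgeForm α u m + edgeForm ε m w := by
  have s1 : 0 < Real.sin α := Real.sin_pos_of_pos_of_lt_pi hα (by linarith)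
  have s2 : 0 < Real.sin ε := Real.sin_pos_of_pos_of_lt_pi hε (by linarith)
  have s3 : 0 < Real.sin (α + ε) := Real.sin_pos_of_pos_of_lt_pi (by linarith) h
  have hpq : Real.cos α / Real.sin α + Real.cos ε / Real.sin ε =
      Real.sin (α + ε) / (Real.sin α * Real.sin ε) := by
    rw [Real.sin_add]
    field_simp
    ring
  have hr : Real.cos (α + ε) / Real.sin (α + ε) *
      (Real.cos α / Real.sin α + Real.cos ε / Real.sin ε) =
        Real.cos α / Real.sin α * (Real.cos ε / Real.sin ε) - 1 := by
    rw [hpq, Real.cos_add]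
    field_simp
  have hpos : 0 < Real.cos α / Real.sin α + Real.cos ε / Real.sin ε := by
    rw [hpq]
    positivity
  unfold edgeForm
  generalize Real.cos α / Real.sin α = p at *
  generalize Real.cos ε / Real.sin ε = q at *
  generalize Real.cos (α + ε) / Real.sin (α + ε) = r at *
  simp only [Complex.normSq_apply, Complex.mul_im, Complex.sub_re, Complex.sub_im,
    Complex.star_def, Complex.conj_re, Complex.conj_im]
  rw [← sub_nonneg]
  refine nonneg_of_mul_nonneg_right (a := p + q) ?_ hpos
  have key : (p + q) * (p * ((u.re - m.re) * (u.re - m.re) + (u.im - m.im) * (u.im - m.im)) +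
      2 * (u.re * -m.im + u.im * m.re) +
      (q * ((m.re - w.re) * (m.re - w.re) + (m.im - w.im) * (m.im - w.im)) +
      2 * (m.re * -w.im + m.im * w.re)) -
      (r * ((u.re - w.re) * (u.re - w.re) + (u.im - w.im) * (u.im - w.im)) +
      2 * (u.re * -w.im + u.im * w.re))) =
      ((p + q) * (m.re - u.re) - q * (w.re - u.re) - (w.im - u.im)) ^ 2 +
      ((p + q) * (m.im - u.im) - q * (w.im - u.im) + (w.re - u.re)) ^ 2 := by
    linear_combination (-((u.re - w.re) * (u.re - w.re) + (u.im - w.im) * (u.im - w.im))) * hr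
  rw [key]
  positivity

theorem edgeForm_sum_le (ε : ℕ → ℝ) (u : ℕ → ℂ) (hε : ∀ i, 0 < ε i) (k : ℕ)
    (h : ∑ i ∈ Finset.range (k + 1), ε i < Real.pi) :
    edgeForm (∑ i ∈ Finset.range (k + 1), ε i) (u 0) (u (k + 1)) ≤
      ∑ i ∈ Finset.range (k + 1), edgeForm (ε i) (u i) (u (i + 1)) := by
  induction k with
  | zero => simp
  | succ k ih =>
    rw [Finset.sum_range_succ] at h
    rw [Finset.sum_range_succ, Finset.sum_range_succ _ (k + 1)]
    have hpos : 0 < ∑ i ∈ Finset.range (k + 1), ε i :=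
      Finset.sum_pos (fun i _ => hε i) ⟨0, by simp⟩
    have := hε (k + 1)
    exact (edgeForm_add_le hpos this h _ (u (k + 1)) _).trans
      (add_le_add_left (ih (by linarith)) _)

open Fin.NatCast in
theorem Fin.sum_univ_cyclic {M : Type*} [AddCommMonoid M] {m : ℕ}
    (f : Fin (m + 1) → Fin (m + 1) → M) :
    ∑ i, f i (i + 1) =
      ∑ i ∈ Finset.range m, f (i : Fin (m + 1)) ((i + 1 : ℕ) : Fin (m + 1)) + f (m : Fin (m + 1)) 0 := by
  rw [Fin.sum_univ_castSucc, Finset.sum_range]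
  simp [Fin.last_add_one]

open Fin.NatCast in
theorem edgeForm_cyclic_nonneg {m : ℕ} (ε : Fin (m + 1) → ℝ) (u : Fin (m + 1) → ℂ)
    (hε : ∀ i, 0 < ε i) (h : ∑ i, ε i ≤ Real.pi) : 0 ≤ ∑ i, edgeForm (ε i) (u i) (u (i + 1)) := by
  rcases m with _ | m
  · simp [edgeForm, Complex.mul_conj]
  rw [Fin.sum_univ_cyclic fun i j => edgeForm (ε i) (u i) (u j)]
  have h' := h
  rw [Fin.sum_univ_cyclic fun i _ => ε i] at h'
  have hl := hε ((m + 1 : ℕ) : Fin (m + 1 + 1))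
  have hchain := edgeForm_sum_le (fun i => ε (i : Fin (m + 1 + 1))) (fun i => u (i : Fin (m + 1 + 1)))
    (fun i => hε _) m (by linarith)
  have hpos : 0 < ∑ i ∈ Finset.range (m + 1), ε (i : Fin (m + 1 + 1)) :=
    Finset.sum_pos (fun i _ => hε _) ⟨0, by simp⟩
  refine le_trans ?_ (add_le_add_left hchain _)
  generalize ∑ i ∈ Finset.range (m + 1), ε (i : Fin (m + 1 + 1)) = α at *
  generalize ε ((m + 1 : ℕ) : Fin (m + 1 + 1)) = β at *
  rw [Nat.cast_zero]
  generalize u ((m + 1 : ℕ) : Fin (m + 1 + 1)) = w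
  generalize u 0 = z
  have s1 : 0 < Real.sin α := Real.sin_pos_of_pos_of_lt_pi hpos (by linarith)
  have s2 : 0 < Real.sin β := Real.sin_pos_of_pos_of_lt_pi hl (by linarith)
  have s3 : 0 ≤ Real.sin (α + β) := Real.sin_nonneg_of_nonneg_of_le_pi (by linarith) h'
  have hpq : Real.cos α / Real.sin α + Real.cos β / Real.sin β =
      Real.sin (α + β) / (Real.sin α * Real.sin β) := by
    rw [Real.sin_add]
    field_simp
    ring
  have : edgeForm α z w + edgeForm β w z =
      Real.sin (α + β) / (Real.sin α * Real.sin β) * Complex.normSq (z - w) := by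
    rw [← hpq]
    simp only [edgeForm, Complex.normSq_apply, Complex.mul_im, Complex.sub_re, Complex.sub_im,
      Complex.star_def, Complex.conj_re, Complex.conj_im]
    ring
  rw [this]
  exact mul_nonneg (div_nonneg s3 (mul_pos s1 s2).le) (Complex.normSq_nonneg _)

theorem re_mul_mul_star (a u w : ℂ) :
    (a * (u * star w)).re = a.re * ((Complex.normSq u + Complex.normSq w) / 2) -
      (a.re * Complex.normSq (u - w) + a.im * (2 * (u * star w).im)) / 2 := by
  simp only [Complex.normSq_apply, Complex.mul_im, Complex.mul_re, Complex.sub_re, Complex.sub_im,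
      Complex.star_def, Complex.conj_re, Complex.conj_im]
  ring

namespace IsPhaseMax

variable {m : ℕ} {a : Fin (m + 1) → ℂ}

theorem form_le_of_pos (ha : IsPhaseMax a) (hpos : 0 < (a 0).im) (u : Fin (m + 1) → ℂ) :
    ∑ i, (a i * (u i * star (u (i + 1)))).re ≤
      ∑ i, (a i).re * ((Complex.normSq (u i) + Complex.normSq (u (i + 1))) / 2) := by
  have him : ∀ i, 0 < (a i).im := fun i => by rwa [ha.im_eq_im i 0]
  have harg : ∀ i, 0 < (a i).arg := fun i => by
    rcases (Complex.arg_nonneg_iff.mpr (him i).le).lt_or_eq with h0 | h0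
    · exact h0
    · exact absurd (Complex.arg_eq_zero_iff.mp h0.symm).2 (him i).ne'
  have hedge : ∀ i, (a i).re * Complex.normSq (u i - u (i + 1)) +
      (a i).im * (2 * (u i * star (u (i + 1))).im) =
        (a 0).im * edgeForm (a i).arg (u i) (u (i + 1)) := by
    intro i
    have hn : ‖a i‖ ≠ 0 := norm_ne_zero_iff.mpr fun h0 => by simpa [h0] using him i
    have : Real.cos (a i).arg / Real.sin (a i).arg = (a i).re / (a i).im := by
      conv_rhs => rw [← Complex.norm_mul_cos_arg, ← Complex.norm_mul_sin_arg]
      rw [mul_div_mul_left _ _ hn]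
    rw [edgeForm, this, ← ha.im_eq_im i 0]
    have := (him i).ne'
    field_simp
  simp only [re_mul_mul_star, Finset.sum_sub_distrib, hedge, ← Finset.sum_div, ← Finset.mul_sum]
  have := edgeForm_cyclic_nonneg (fun i => (a i).arg) u harg (ha.sum_arg_le_pi him)
  have := mul_nonneg hpos.le this
  linarith

theorem sum_sub_cyclic (x : Fin (m + 1) → ℝ) : ∑ i, (x i - x (i + 1)) = 0 := by
  rw [Finset.sum_sub_distrib, sub_eq_zero]
  exact (Equiv.sum_comp (Equiv.addRight (1 : Fin (m + 1))) x).symm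

theorem form_le (ha : IsPhaseMax a) (u : Fin (m + 1) → ℂ) :
    ∑ i, (a i * (u i * star (u (i + 1)))).re ≤
      ∑ i, (a i).re * ((Complex.normSq (u i) + Complex.normSq (u (i + 1))) / 2) := by
  rcases lt_trichotomy (a 0).im 0 with h0 | h0 | h0
  · have h := ha.conj.form_le_of_pos (by simpa using h0) fun i => star (u i)
    have e : ∀ i, (star (a i) * (star (u i) * star (star (u (i + 1))))).re =
        (a i * (u i * star (u (i + 1)))).re := fun i => by
      rw [← Complex.conj_re]
      simp
    simp only [e] at h
    simpa only [Complex.star_def, Complex.conj_re, Complex.normSq_conj] using h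
  · have him : ∀ i, (a i).im = 0 := fun i => by rw [ha.im_eq_im i 0, h0]
    have h1 := ha.sum_re_mul_sq_nonneg (sum_sub_cyclic fun i => (u i).re)
    have h2 := ha.sum_re_mul_sq_nonneg (sum_sub_cyclic fun i => (u i).im)
    have h3 := add_nonneg h1 h2
    rw [← Finset.sum_add_distrib] at h3
    simp only [re_mul_mul_star, Finset.sum_sub_distrib, him, zero_mul, add_zero, ← Finset.sum_div]
    have e : ∀ i, (a i).re * ((u i).re - (u (i + 1)).re) ^ 2 +
        (a i).re * ((u i).im - (u (i + 1)).im) ^ 2 =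
          (a i).re * Complex.normSq (u i - u (i + 1)) := fun i => by
      simp only [Complex.normSq_apply, Complex.sub_re, Complex.sub_im]
      ring
    simp only [e] at h3
    linarith
  · exact ha.form_le_of_pos h0 u

end IsPhaseMax

open Fin.NatCast in
/-- Among the vectors `v` with prescribed moduli there is one whose cyclically consecutive products
have the best phases. -/
theorem exists_isPhaseMax {m : ℕ} (h : Fin (m + 1) → ℂ) (r : Fin (m + 1) → ℝ) (hr : ∀ i, 0 ≤ r i) :
    ∃ v : Fin (m + 1) → ℂ, (∀ i, ‖v i‖ = r i) ∧
      IsPhaseMax fun i => h i * (v i * star (v (i + 1))) := by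
  have hc : IsCompact (Set.univ.pi fun i => Metric.sphere (0 : ℂ) (r i)) :=
    isCompact_univ_pi fun i => isCompact_sphere _ _
  have hne : (Set.univ.pi fun i => Metric.sphere (0 : ℂ) (r i)).Nonempty :=
    ⟨fun i => r i, fun i _ => by simp [abs_of_nonneg (hr i)]⟩
  obtain ⟨v, hv, hmax⟩ := hc.exists_isMaxOn hne
    (f := fun v => ∑ i, (h i * (v i * star (v (i + 1)))).re) (by fun_prop)
  refine ⟨v, fun i => by simpa using hv i trivial, fun δ k hδ => ?_⟩
  set θ : Fin (m + 1) → ℝ := fun j => -∑ l ∈ Finset.range j, δ (l : Fin (m + 1)) with hθ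
  have hstep : ∀ i, Complex.exp (θ i * Complex.I) * star (Complex.exp (θ (i + 1) * Complex.I)) =
      Complex.exp (δ i * Complex.I) := by
    intro i
    rw [Complex.star_def, ← Complex.exp_conj, ← Complex.exp_add]
    simp only [map_mul, Complex.conj_ofReal, Complex.conj_I]
    rcases Fin.eq_castSucc_or_eq_last i with ⟨j, rfl⟩ | rfl
    · congr 1
      rw [Fin.coeSucc_eq_succ]
      simp only [hθ, Fin.val_succ, Finset.sum_range_succ, Fin.val_castSucc, Fin.coe_eq_castSucc]
      push_cast
      ring
    · rw [Fin.last_add_one, Complex.exp_eq_exp_iff_exists_int]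
      refine ⟨-k, ?_⟩
      have h1 := hδ
      rw [Fin.sum_univ_castSucc] at h1
      have h2 : ∑ l ∈ Finset.range m, δ (l : Fin (m + 1)) = ∑ j : Fin m, δ j.castSucc := by
        rw [Finset.sum_range]
        simp
      simp only [hθ, Fin.val_last, h2, Fin.val_zero, Finset.range_zero, Finset.sum_empty, neg_zero]
      have h3 : ((∑ j : Fin m, δ j.castSucc : ℝ) : ℂ) =
          k * (2 * Real.pi) - (δ (Fin.last m) : ℝ) := by
        rw [eq_sub_iff_add_eq]
        exact_mod_cast h1
      rw [Complex.ofReal_neg, h3]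
      push_cast
      ring
  have hmem : (fun i => v i * Complex.exp (θ i * Complex.I)) ∈
      Set.univ.pi fun i => Metric.sphere (0 : ℂ) (r i) := by
    intro i _
    have := hv i trivial
    simpa [Complex.norm_exp_ofReal_mul_I] using this
  have hle := hmax hmem
  simp only [Set.mem_ofPred_eq] at hle
  refine le_of_eq_of_le (Finset.sum_congr rfl fun i _ => ?_) hle
  rw [← hstep i, star_mul']
  congr 1
  ring

/-- On a cycle, a linear functional of the entries of a positive semidefinite matrix along the
edges is dominated by its value at a rank one matrix with the same diagonal. -/
theorem Matrix.PosSemidef.exists_cyclic_le {m : ℕ} {W : Matrix (Fin (m + 1)) (Fin (m + 1)) ℂ}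
    (hW : W.PosSemidef) (h : Fin (m + 1) → ℂ) :
    ∃ v : Fin (m + 1) → ℂ, (∀ i, ‖v i‖ ^ 2 = (W i i).re) ∧
      ∑ i, (h i * W i (i + 1)).re ≤ ∑ i, (h i * (v i * star (v (i + 1)))).re := by
  have hdiag : ∀ i, 0 ≤ (W i i).re := fun i => (Complex.nonneg_iff.mp hW.diag_nonneg).1
  obtain ⟨v, hv, hmax⟩ := exists_isPhaseMax h (fun i => √(W i i).re) fun i => Real.sqrt_nonneg _
  have hv2 : ∀ i, ‖v i‖ ^ 2 = (W i i).re := fun i => by rw [hv, Real.sq_sqrt (hdiag i)]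
  refine ⟨v, hv2, ?_⟩
  obtain ⟨n, b, rfl⟩ := Matrix.posSemidef_iff_eq_sum_vecMulVec.mp hW
  have hentry : ∀ i j, (∑ s, Matrix.vecMulVec (b s) (star (b s))) i j =
      ∑ s, b s i * star (b s j) := fun i j => by
    simp [Matrix.sum_apply, Matrix.vecMulVec_apply]
  have hd : ∀ i, ‖v i‖ ^ 2 = ∑ s, Complex.normSq (b s i) := fun i => by
    rw [hv2, hentry, Complex.re_sum]
    simp [Complex.mul_conj]
  have hb : ∀ s i, b s i = v i * (b s i / v i) := by
    intro s i
    by_cases h0 : v i = 0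
    · have := hd i
      rw [h0, norm_zero, zero_pow two_ne_zero, eq_comm,
        Finset.sum_eq_zero_iff_of_nonneg fun _ _ => Complex.normSq_nonneg _] at this
      simpa [h0] using this s (Finset.mem_univ s)
    · field_simp
  have hu : ∀ i, v i ≠ 0 → ∑ s, Complex.normSq (b s i / v i) = 1 := by
    intro i h0
    simp only [map_div₀, ← Finset.sum_div, ← hd]
    rw [Complex.normSq_eq_norm_sq]
    exact div_self (by simpa using h0)
  calc ∑ i, (h i * (∑ s, Matrix.vecMulVec (b s) (star (b s))) i (i + 1)).re
      = ∑ s, ∑ i, (h i * (v i * star (v (i + 1))) *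
          (b s i / v i * star (b s (i + 1) / v (i + 1)))).re := by
        rw [Finset.sum_comm]
        refine Finset.sum_congr rfl fun i _ => ?_
        rw [hentry, Finset.mul_sum, Complex.re_sum]
        refine Finset.sum_congr rfl fun s _ => ?_
        conv_lhs => rw [hb s i, hb s (i + 1), star_mul']
        congr 1
        ring
    _ ≤ ∑ s, ∑ i, (h i * (v i * star (v (i + 1)))).re *
          ((Complex.normSq (b s i / v i) + Complex.normSq (b s (i + 1) / v (i + 1))) / 2) :=
        Finset.sum_le_sum fun s _ => hmax.form_le fun i => b s i / v i
    _ = ∑ i, (h i * (v i * star (v (i + 1)))).re := by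
        rw [Finset.sum_comm]
        refine Finset.sum_congr rfl fun i _ => ?_
        rw [← Finset.mul_sum, ← Finset.sum_div, Finset.sum_add_distrib]
        by_cases h0 : v i = 0
        · simp [h0]
        by_cases h1 : v (i + 1) = 0
        · simp [h1]
        rw [hu i h0, hu _ h1]
        ring

namespace SimpleGraph

open Classical in
/-- The part of a matrix that a network on `G` can see: the diagonal and the entries at edges. -/
noncomputable def mask {V : Type*} (G : SimpleGraph V) (M : V → V → ℂ) : V → V → ℂ :=
  fun i k => if i = k ∨ G.Adj i k then M i k else 0

/-- The masks of the matrices `v vᴴ` with prescribed diagonal `d`. -/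
def rankOneSet {V : Type*} (G : SimpleGraph V) (d : V → ℝ) : Set (V → V → ℂ) :=
  {M | ∃ v : V → ℂ, (∀ i, ‖v i‖ ^ 2 = d i) ∧ M = G.mask fun i k => v i * star (v k)}

/-- Up to entries that the graph does not see, every positive semidefinite matrix is a convex
combination of rank one matrices with the same diagonal. -/
def IsRankOneConvex {V : Type*} (G : SimpleGraph V) : Prop :=
  ∀ W : Matrix V V ℂ, W.PosSemidef → G.mask W ∈ convexHull ℝ (G.rankOneSet fun i => (W i i).re)

theorem IsRankOneConvex.of_iso {V V' : Type*} {G : SimpleGraph V} {G' : SimpleGraph V'}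
    (e : G ≃g G') (h : G'.IsRankOneConvex) : G.IsRankOneConvex := by
  intro W hW
  let L : (V' → V' → ℂ) →ₗ[ℝ] (V → V → ℂ) :=
    { toFun := fun M i k => M (e i) (e k)
      map_add' := fun _ _ => rfl
      map_smul' := fun _ _ => rfl }
  have hmask : ∀ M : V → V → ℂ, L (G'.mask fun i k => M (e.symm i) (e.symm k)) = G.mask M := by
    intro M
    ext i k
    have hadj : (e i = e k ∨ G'.Adj (e i) (e k)) ↔ (i = k ∨ G.Adj i k) :=
      or_congr e.injective.eq_iff e.map_adj_iff
    simp only [L, mask, LinearMap.coe_mk, AddHom.coe_mk, RelIso.symm_apply_apply]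
    by_cases hik : i = k ∨ G.Adj i k
    · rw [if_pos (hadj.mpr hik), if_pos hik]
    · rw [if_neg (mt hadj.mp hik), if_neg hik]
  have h1 := Set.mem_image_of_mem L (h _ (hW.submatrix e.symm))
  rw [LinearMap.image_convexHull] at h1
  rw [← hmask W]
  refine convexHull_mono ?_ h1
  rintro _ ⟨_, ⟨v, hv, rfl⟩, rfl⟩
  refine ⟨fun i => v (e i), fun i => by simpa using hv (e i), ?_⟩
  rw [← hmask]
  simp

/-- The Hermitian matrix with entry `t` at `(a, b)`, its conjugate at `(b, a)`, and zeros
elsewhere. -/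
noncomputable def edgeMatrix {V : Type*} [DecidableEq V] (a b : V) : ℂ →ₗ[ℝ] (V → V → ℂ) where
  toFun t i k := if i = a ∧ k = b then t else if i = b ∧ k = a then star t else 0
  map_add' s t := by
    ext i k
    simp only [Pi.add_apply]
    split_ifs <;> simp
  map_smul' c t := by
    ext i k
    simp only [Pi.smul_apply]
    split_ifs <;> simp

theorem mask_eq_add_edgeMatrix {V : Type*} [DecidableEq V] {G : SimpleGraph V} {a b : V}
    (hab : G.Adj a b) {M M' : V → V → ℂ} (hM : M b a = star (M a b))
    (h : ∀ i k, i = k ∨ (G.deleteEdges {s(a, b)}).Adj i k → M' i k = M i k) :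
    G.mask M = (G.deleteEdges {s(a, b)}).mask M' + edgeMatrix a b (M a b) := by
  have hne := hab.ne
  ext i k
  by_cases h1 : i = a ∧ k = b
  · obtain ⟨rfl, rfl⟩ := h1
    simp [mask, edgeMatrix, hab, hne]
  by_cases h2 : i = b ∧ k = a
  · obtain ⟨rfl, rfl⟩ := h2
    simp [mask, edgeMatrix, hab.symm, hne, hne.symm, hM]
  have hiff : (i = k ∨ (G.deleteEdges {s(a, b)}).Adj i k) ↔ (i = k ∨ G.Adj i k) := by
    simp only [deleteEdges_adj, Set.mem_singleton_iff, Sym2.eq_iff]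
    tauto
  have h3 : edgeMatrix a b (M a b) i k = 0 := by simp [edgeMatrix, h1, h2]
  rw [Pi.add_apply, Pi.add_apply, h3, add_zero]
  by_cases h4 : i = k ∨ G.Adj i k
  · simp only [mask, if_pos h4, if_pos (hiff.mpr h4), h i k (hiff.mpr h4)]
  · simp only [mask, if_neg h4, if_neg (mt hiff.mp h4)]

theorem add_edgeMatrix_mem_rankOneSet {V : Type*} [DecidableEq V] {G : SimpleGraph V} {a b : V}
    (hab : G.Adj a b) (hbr : G.IsBridge s(a, b)) {d : V → ℝ} {M : V → V → ℂ}
    (hM : M ∈ (G.deleteEdges {s(a, b)}).rankOneSet d) {t : ℂ} (ht : ‖t‖ = √(d a) * √(d b)) :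
    M + edgeMatrix a b t ∈ G.rankOneSet d := by
  classical
  obtain ⟨v, hv, rfl⟩ := hM
  have hsq : ∀ i, √(d i) = ‖v i‖ := fun i => by rw [← hv i, Real.sqrt_sq (norm_nonneg _)]
  rw [hsq, hsq] at ht
  obtain ⟨τ, hτ, hτt⟩ : ∃ τ : ℂ, ‖τ‖ = 1 ∧ τ * (v a * star (v b)) = t := by
    by_cases h0 : v a * star (v b) = 0
    · refine ⟨1, by simp, ?_⟩
      have : ‖t‖ = 0 := by rw [ht, ← norm_star (v b), ← norm_mul, h0, norm_zero]
      rw [h0, mul_zero, norm_eq_zero.mp this]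
    · refine ⟨t / (v a * star (v b)), ?_, div_mul_cancel₀ t h0⟩
      have : ‖v a * star (v b)‖ = ‖t‖ := by rw [ht, norm_mul, norm_star]
      rw [norm_div, this]
      exact div_self (this ▸ norm_ne_zero_iff.mpr h0)
  have hττ : τ * star τ = 1 := by
    rw [Complex.star_def, Complex.mul_conj, Complex.normSq_eq_norm_sq, hτ]
    simp
  set G' := G.deleteEdges {s(a, b)} with hG'
  set v' : V → ℂ := fun i => if G'.Reachable a i then τ * v i else v i with hv'
  refine ⟨v', fun i => ?_, ?_⟩
  · simp only [hv']
    split_ifs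
    · rw [norm_mul, hτ, one_mul, hv]
    · exact hv i
  · have hb : ¬ G'.Reachable a b := isBridge_iff.mp hbr
    have hab' : v' a * star (v' b) = t := by
      simp only [hv', if_pos (Reachable.refl a), if_neg hb, ← hτt, mul_assoc]
    rw [mask_eq_add_edgeMatrix hab (M := fun i k => v' i * star (v' k))
      (M' := fun i k => v i * star (v k)) ?_ ?_, hab']
    · simp [mul_comm]
    · intro i k hik
      have hr : G'.Reachable a i ↔ G'.Reachable a k := by
        rcases hik with rfl | hik
        · rfl
        · exact ⟨fun h => h.trans hik.reachable, fun h => h.trans hik.symm.reachable⟩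
      by_cases h : G'.Reachable a i
      · simp only [hv', if_pos h, if_pos (hr.mp h), star_mul']
        linear_combination (-(v i * star (v k))) * hττ
      · simp only [hv', if_neg h, if_neg (mt hr.mpr h)]

end SimpleGraph

theorem Matrix.PosSemidef.norm_apply_le {n : Type*} [Fintype n] {A : Matrix n n ℂ}
    (hA : A.PosSemidef) (i j : n) : ‖A i j‖ ≤ √(A i i).re * √(A j j).re := by
  obtain ⟨m, v, rfl⟩ := hA.exists_eq_gram
  have : ∀ i, √(Matrix.gram ℂ v i i).re = ‖v i‖ := fun i => by
    rw [Matrix.gram_apply, inner_self_eq_norm_sq_to_K]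
    norm_cast
    exact Real.sqrt_sq (norm_nonneg _)
  rw [this, this]
  exact norm_inner_le_norm (𝕜 := ℂ) (v i) (v j)

theorem Matrix.PosSemidef.ofReal_re_diag {n : Type*} {A : Matrix n n ℂ}
    (hA : A.PosSemidef) (i : n) : (((A i i).re : ℝ) : ℂ) = A i i := by
  have h := Complex.nonneg_iff.mp (hA.diag_nonneg (i := i))
  apply Complex.ext <;> simp [h.2.symm]

namespace SimpleGraph

theorem IsAcyclic.isRankOneConvex {V : Type*} [Finite V] {G : SimpleGraph V} (hG : G.IsAcyclic) :
    G.IsRankOneConvex := by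
  classical
  have := Fintype.ofFinite V
  intro W hW
  induction G using WellFoundedLT.induction with
  | ind G ih =>
  by_cases hE : ∃ a b, G.Adj a b
  · obtain ⟨a, b, hab⟩ := hE
    have hbr : G.IsBridge s(a, b) := isAcyclic_iff_forall_adj_isBridge.mp hG hab
    have hlt : G.deleteEdges {s(a, b)} < G := lt_of_le_of_ne (deleteEdges_le _) fun h => by
      have h' := hab
      rw [← h] at h'
      simp at h'
    have h1 := ih _ hlt (hG.anti hlt.le)
    rw [mask_eq_add_edgeMatrix hab (M' := W) (hW.isHermitian.apply b a).symm fun _ _ _ => rfl]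
    set d : V → ℝ := fun i => (W i i).re
    suffices hs : convexHull ℝ ((G.deleteEdges {s(a, b)}).rankOneSet d) ⊆
        (fun M => M + edgeMatrix a b (W a b)) ⁻¹' convexHull ℝ (G.rankOneSet d) from hs h1
    refine convexHull_min (fun M hM => ?_) ((convex_convexHull ℝ _).translate_preimage_left _)
    suffices hs : convexHull ℝ (Metric.sphere (0 : ℂ) (√(d a) * √(d b))) ⊆
        edgeMatrix a b ⁻¹' ((fun E => M + E) ⁻¹' convexHull ℝ (G.rankOneSet d)) by
      refine hs ?_
      rw [convexHull_sphere_eq_closedBall _ (by positivity), mem_closedBall_zero_iff]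
      exact hW.norm_apply_le a b
    refine convexHull_min (fun t ht => subset_convexHull ℝ _ ?_)
      (((convex_convexHull ℝ _).translate_preimage_right _).linear_preimage _)
    exact add_edgeMatrix_mem_rankOneSet hab hbr hM (mem_sphere_zero_iff_norm.mp ht)
  · refine subset_convexHull ℝ _ ⟨fun i => (√(W i i).re : ℝ), fun i => ?_, ?_⟩
    · rw [Complex.norm_real, Real.norm_eq_abs, sq_abs,
        Real.sq_sqrt (Complex.nonneg_iff.mp hW.diag_nonneg).1]
    · ext i k
      by_cases hik : i = k
      · subst hik
        simp only [mask, true_or, if_true, Complex.star_def, Complex.conj_ofReal]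
        rw [← Complex.ofReal_mul, Real.mul_self_sqrt (Complex.nonneg_iff.mp hW.diag_nonneg).1,
          hW.ofReal_re_diag]
      · have : ¬ G.Adj i k := fun h => hE ⟨i, k, h⟩
        simp [mask, hik, this]

end SimpleGraph

/-- The vector of the entries along a cycle of a positive semidefinite matrix is a convex
combination of such vectors of rank one matrices with the same diagonal. -/
theorem Matrix.PosSemidef.cyclic_mem_convexHull {m : ℕ}
    {W : Matrix (Fin (m + 1)) (Fin (m + 1)) ℂ} (hW : W.PosSemidef) :
    (fun i => W i (i + 1)) ∈ convexHull ℝ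
      ((fun (v : Fin (m + 1) → ℂ) i => v i * star (v (i + 1))) ''
        {v | ∀ i, ‖v i‖ ^ 2 = (W i i).re}) := by
  have hset : {v : Fin (m + 1) → ℂ | ∀ i, ‖v i‖ ^ 2 = (W i i).re} =
      Set.univ.pi fun i => Metric.sphere (0 : ℂ) √(W i i).re := by
    ext v
    simp only [Set.mem_ofPred_eq, Set.mem_pi, Set.mem_univ, true_imp_iff,
      mem_sphere_zero_iff_norm]
    refine forall_congr' fun i => ?_
    have h0 := (Complex.nonneg_iff.mp (hW.diag_nonneg (i := i))).1
    rw [eq_comm, eq_comm (b := √_), Real.sqrt_eq_iff_eq_sq h0 (norm_nonneg _)]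
  have hc : IsCompact ((fun (v : Fin (m + 1) → ℂ) i => v i * star (v (i + 1))) ''
        {v | ∀ i, ‖v i‖ ^ 2 = (W i i).re}) := by
    rw [hset]
    exact (isCompact_univ_pi fun i => isCompact_sphere _ _).image (by fun_prop)
  by_contra hnot
  obtain ⟨f, c, hf, hfW⟩ := geometric_hahn_banach_closed_point (convex_convexHull ℝ _)
    hc.convexHull_of_finiteDimensional.isClosed hnot
  set h : Fin (m + 1) → ℂ := fun i => f (Pi.single i 1) - Complex.I * f (Pi.single i Complex.I)
    with hh
  have hfe : ∀ z, f z = ∑ i, (h i * z i).re := by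
    intro z
    conv_lhs => rw [← Finset.univ_sum_single z, map_sum]
    refine Finset.sum_congr rfl fun i _ => ?_
    have e : (Pi.single i (z i) : Fin (m + 1) → ℂ) =
        (z i).re • (Pi.single i 1 : Fin (m + 1) → ℂ) +
          (z i).im • (Pi.single i Complex.I : Fin (m + 1) → ℂ) := by
      rw [← Pi.single_smul, ← Pi.single_smul, ← Pi.single_add]
      congr 1
      simp
    rw [e, map_add, map_smul, map_smul]
    simp [hh, Complex.mul_re]
    ring
  obtain ⟨v, hv, hle⟩ := hW.exists_cyclic_le h
  have := hf _ (subset_convexHull ℝ _ ⟨v, hv, rfl⟩)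
  rw [hfe] at this hfW
  linarith

namespace SimpleGraph

theorem isRankOneConvex_cycleGraph (m : ℕ) : (cycleGraph (m + 3)).IsRankOneConvex := by
  classical
  intro W hW
  set d : Fin (m + 3) → ℝ := fun i => (W i i).re with hd
  let D : Fin (m + 3) → Fin (m + 3) → ℂ := fun i k => if i = k then (d i : ℂ) else 0
  let L : (Fin (m + 3) → ℂ) →ₗ[ℝ] (Fin (m + 3) → Fin (m + 3) → ℂ) :=
    { toFun := fun z i k => if k = i + 1 then z i else if i = k + 1 then star (z k) else 0
      map_add' := fun s t => by
        ext i k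
        simp only [Pi.add_apply]
        split_ifs <;> simp
      map_smul' := fun c t => by
        ext i k
        simp only [Pi.smul_apply]
        split_ifs <;> simp }
  have h1 : ∀ i : Fin (m + 3), i ≠ i + 1 := fun i h => by simp at h
  have h2 : ∀ i : Fin (m + 3), i ≠ i + 1 + 1 := fun i h => by
    rw [add_assoc, left_eq_add, Fin.ext_iff, Fin.val_add] at h
    simp only [Fin.val_one, Fin.val_zero, Nat.reduceAdd] at h
    rw [Nat.mod_eq_of_lt (by omega)] at h
    exact two_ne_zero h
  have hmask : ∀ M : Fin (m + 3) → Fin (m + 3) → ℂ, (∀ i k, M k i = star (M i k)) →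
      (∀ i, M i i = d i) → (cycleGraph (m + 3)).mask M = D + L fun i => M i (i + 1) := by
    intro M hM hMd
    ext i k
    have hadj : (cycleGraph (m + 3)).Adj i k ↔ i = k + 1 ∨ k = i + 1 := by
      rw [cycleGraph_adj, sub_eq_iff_eq_add', sub_eq_iff_eq_add']
    simp only [mask, hadj, Pi.add_apply, D, L, LinearMap.coe_mk, AddHom.coe_mk]
    by_cases hik : i = k
    · subst hik
      simp [hMd]
    by_cases h3 : k = i + 1
    · subst h3
      simp
    by_cases h4 : i = k + 1
    · subst h4
      simp [hM k (k + 1), h2]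
    simp [hik, h3, h4]
  have hmem := Set.mem_image_of_mem L hW.cyclic_mem_convexHull
  rw [LinearMap.image_convexHull] at hmem
  rw [hmask W (fun i k => (hW.isHermitian.apply k i).symm) fun i => (hW.ofReal_re_diag i).symm]
  suffices hs : convexHull ℝ (L '' ((fun (v : Fin (m + 3) → ℂ) i => v i * star (v (i + 1))) ''
        {v | ∀ i, ‖v i‖ ^ 2 = (W i i).re})) ⊆
      (fun M => D + M) ⁻¹' convexHull ℝ ((cycleGraph (m + 3)).rankOneSet d) from hs hmem
  refine convexHull_min ?_ ((convex_convexHull ℝ _).translate_preimage_right _)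
  rintro _ ⟨_, ⟨v, hv, rfl⟩, rfl⟩
  refine subset_convexHull ℝ _ ⟨v, hv, ?_⟩
  rw [hmask (fun i k => v i * star (v k)) (fun i k => by simp [mul_comm]) fun i => ?_]
  rw [Complex.star_def, Complex.mul_conj, Complex.normSq_eq_norm_sq, hv i]

theorem IsRankOneConvex.glue {U V W : Type*} {G : SimpleGraph U} {H : SimpleGraph V}
    {K : SimpleGraph W} (φ : U ↪ W) (ψ : V ↪ W) {a : U} {b : V}
    (hcov : ∀ w, w ∈ Set.range φ ∨ w ∈ Set.range ψ)
    (hab : ∀ i j, φ i = ψ j ↔ i = a ∧ j = b)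
    (hG : ∀ i k, K.Adj (φ i) (φ k) ↔ G.Adj i k) (hH : ∀ j l, K.Adj (ψ j) (ψ l) ↔ H.Adj j l)
    (hno : ∀ i j, i ≠ a → j ≠ b → ¬ K.Adj (φ i) (ψ j))
    (cG : G.IsRankOneConvex) (cH : H.IsRankOneConvex) : K.IsRankOneConvex := by
  classical
  have : Nonempty U := ⟨a⟩
  have : Nonempty V := ⟨b⟩
  obtain ⟨ρ, hρ⟩ := φ.injective.hasLeftInverse
  obtain ⟨σ, hσ⟩ := ψ.injective.hasLeftInverse
  have hba : ψ b = φ a := ((hab a b).mpr ⟨rfl, rfl⟩).symm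
  let L : (U → U → ℂ) × (V → V → ℂ) →ₗ[ℝ] (W → W → ℂ) :=
    { toFun := fun P w w' =>
        if w ∈ Set.range φ ∧ w' ∈ Set.range φ then P.1 (ρ w) (ρ w')
        else if w ∈ Set.range ψ ∧ w' ∈ Set.range ψ then P.2 (σ w) (σ w') else 0
      map_add' := fun s t => by
        ext i k
        simp only [Pi.add_apply, Prod.fst_add, Prod.snd_add]
        split_ifs <;> simp
      map_smul' := fun c t => by
        ext i k
        simp only [Pi.smul_apply, Prod.smul_fst, Prod.smul_snd]
        split_ifs <;> simp }
  have hmask : ∀ M : W → W → ℂ,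
      L (G.mask fun i k => M (φ i) (φ k), H.mask fun j l => M (ψ j) (ψ l)) = K.mask M := by
    intro M
    ext w w'
    simp only [L, LinearMap.coe_mk, AddHom.coe_mk]
    by_cases h1 : w ∈ Set.range φ ∧ w' ∈ Set.range φ
    · rw [if_pos h1]
      obtain ⟨⟨i, rfl⟩, ⟨k, rfl⟩⟩ := h1
      simp only [mask, hρ i, hρ k, hG, φ.injective.eq_iff]
    rw [if_neg h1]
    by_cases h2 : w ∈ Set.range ψ ∧ w' ∈ Set.range ψ
    · rw [if_pos h2]
      obtain ⟨⟨j, rfl⟩, ⟨l, rfl⟩⟩ := h2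
      simp only [mask, hσ j, hσ l, hH, ψ.injective.eq_iff]
    rw [if_neg h2]
    have key : ∀ i j, ¬ (φ i ∈ Set.range φ ∧ ψ j ∈ Set.range φ) →
        ¬ (φ i ∈ Set.range ψ ∧ ψ j ∈ Set.range ψ) → φ i ≠ ψ j ∧ ¬ K.Adj (φ i) (ψ j) := by
      intro i j hi hj
      have hi' : i ≠ a := by
        rintro rfl
        exact hj ⟨⟨b, hba⟩, ⟨j, rfl⟩⟩
      have hj' : j ≠ b := by
        rintro rfl
        exact hi ⟨⟨i, rfl⟩, ⟨a, hba.symm⟩⟩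
      exact ⟨fun h => hi' ((hab i j).mp h).1, hno i j hi' hj'⟩
    have hnot : ¬ (w = w' ∨ K.Adj w w') := by
      rcases hcov w with ⟨i, rfl⟩ | ⟨j, rfl⟩ <;> rcases hcov w' with ⟨k, rfl⟩ | ⟨l, rfl⟩
      · exact absurd ⟨⟨i, rfl⟩, ⟨k, rfl⟩⟩ h1
      · have := key i l h1 h2
        tauto
      · have := key k j (by tauto) (by tauto)
        rw [eq_comm, K.adj_comm]
        tauto
      · exact absurd ⟨⟨j, rfl⟩, ⟨l, rfl⟩⟩ h2
    simp only [mask, if_neg hnot]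
  intro A hA
  have hmem : (G.mask fun i k => A (φ i) (φ k), H.mask fun j l => A (ψ j) (ψ l)) ∈ convexHull ℝ
      ((G.rankOneSet fun i => (A (φ i) (φ i)).re) ×ˢ (H.rankOneSet fun j => (A (ψ j) (ψ j)).re)) := by
    rw [convexHull_prod]
    exact ⟨cG _ (hA.submatrix φ), cH _ (hA.submatrix ψ)⟩
  have hmem := Set.mem_image_of_mem L hmem
  rw [LinearMap.image_convexHull] at hmem
  refine convexHull_mono ?_ (Set.mem_of_eq_of_mem (hmask A).symm hmem)
  rintro _ ⟨⟨_, _⟩, ⟨⟨v, hv, rfl⟩, ⟨u, hu, rfl⟩⟩, rfl⟩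
  have hnorm : ‖v a‖ = ‖u b‖ := by
    rw [← sq_eq_sq₀ (norm_nonneg _) (norm_nonneg _)]
    have h1 := hv a
    have h2 := hu b
    simp only [hba] at h1 h2
    rw [h1, h2]
  obtain ⟨τ, hτ, hτu⟩ : ∃ τ : ℂ, ‖τ‖ = 1 ∧ τ * u b = v a := by
    by_cases h0 : u b = 0
    · refine ⟨1, by simp, ?_⟩
      rw [h0, norm_zero, norm_eq_zero] at hnorm
      rw [h0, hnorm, mul_zero]
    · refine ⟨v a / u b, ?_, by field_simp⟩
      rw [norm_div, hnorm]
      exact div_self (norm_ne_zero_iff.mpr h0)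
  have hττ : τ * star τ = 1 := by
    rw [Complex.star_def, Complex.mul_conj, Complex.normSq_eq_norm_sq, hτ]
    simp
  set x : W → ℂ := fun w => if w ∈ Set.range φ then v (ρ w) else τ * u (σ w) with hx
  have hxφ : ∀ i, x (φ i) = v i := fun i => by simp [hx, hρ i]
  have hxψ : ∀ j, x (ψ j) = τ * u j := by
    intro j
    by_cases hj : j = b
    · rw [hj, hba, hxφ, hτu]
    · have : ψ j ∉ Set.range φ := by
        rintro ⟨i, hi⟩
        exact hj ((hab i j).mp hi).2
      simp only [hx, if_neg this, hσ j]
  refine ⟨x, fun w => ?_, ?_⟩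
  · rcases hcov w with ⟨i, rfl⟩ | ⟨j, rfl⟩
    · rw [hxφ, hv]
    · rw [hxψ, norm_mul, hτ, one_mul, hu]
  · rw [← hmask]
    congr 3
    · ext i k
      rw [hxφ, hxφ]
    · ext j l
      rw [hxψ, hxψ, star_mul']
      linear_combination (-(u j * star (u l))) * hττ

end SimpleGraph

namespace Network

theorem IsCycleTreeConnection.isRankOneConvex {V : Type u} [Finite V] {N : Network V}
    (hN : N.IsCycleTreeConnection) : N.graph.IsRankOneConvex := by
  rename_i hfin
  revert hfin
  induction hN with
  | tree N h =>
    intro _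
    exact (SimpleGraph.IsTree.isAcyclic h).isRankOneConvex
  | cycle N h =>
    intro _
    obtain ⟨⟨n, hn, ⟨e⟩⟩, -⟩ := h
    obtain ⟨m, rfl⟩ := Nat.exists_eq_add_of_le' hn
    exact (SimpleGraph.isRankOneConvex_cycleGraph m).of_iso e
  | connect G H K _ _ hK ihG ihH =>
    intro _
    obtain ⟨φ, ψ, a, b, hcov, hab, hG, hH, -, -, -, -, -, hno⟩ := hK
    have := Finite.of_injective φ φ.injective
    have := Finite.of_injective ψ ψ.injective
    exact ihG.glue φ ψ hcov hab hG hH hno ihH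

variable {V : Type u} [Fintype V] (N : Network V)

/-- The real powers, as a linear map. -/
noncomputable def realPowerLinear : (V → V → ℂ) →ₗ[ℝ] (V → ℝ) where
  toFun M i := (∑ k, M i k * star (N.admittance i k)).re
  map_add' s t := by
    ext i
    simp [add_mul, Finset.sum_add_distrib]
  map_smul' c t := by
    ext i
    simp [Finset.mul_sum, mul_assoc]

theorem realPowerLinear_eq (W : Matrix V V ℂ) : N.realPowerLinear W = N.realPower W := by
  ext i
  simp [realPowerLinear, realPower, Matrix.mul_apply]

theorem realPowerLinear_mask (W : V → V → ℂ) :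
    N.realPowerLinear (N.graph.mask W) = N.realPowerLinear W := by
  ext i
  simp only [realPowerLinear, LinearMap.coe_mk, AddHom.coe_mk]
  congr 1
  refine Finset.sum_congr rfl fun k _ => ?_
  by_cases h : i = k ∨ N.graph.Adj i k
  · simp only [SimpleGraph.mask, if_pos h]
  · have : N.admittance i k = 0 := by
      rw [not_or] at h
      simp [admittance, h.1, h.2]
    simp [this]

theorem convex_relaxedRegion (Vlo Vhi : V → ℝ) : Convex ℝ (N.relaxedRegion Vlo Vhi) := by
  rintro _ ⟨A, hA, hAd, rfl⟩ _ ⟨B, hB, hBd, rfl⟩ s t hs ht hst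
  refine ⟨s • A + t • B, (hA.smul hs).add (hB.smul ht), fun i => ?_, ?_⟩
  · have h1 := hAd i
    have h2 := hBd i
    have : ((s • A + t • B) i i).re = s * (A i i).re + t * (B i i).re := by simp
    rw [this]
    constructor
    · calc Vlo i ^ 2 = s * Vlo i ^ 2 + t * Vlo i ^ 2 := by rw [← add_mul, hst, one_mul]
        _ ≤ _ := add_le_add (mul_le_mul_of_nonneg_left h1.1 hs) (mul_le_mul_of_nonneg_left h2.1 ht)
    · calc _ ≤ s * Vhi i ^ 2 + t * Vhi i ^ 2 :=
            add_le_add (mul_le_mul_of_nonneg_left h1.2 hs) (mul_le_mul_of_nonneg_left h2.2 ht)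
        _ = Vhi i ^ 2 := by rw [← add_mul, hst, one_mul]
  · simp only [← realPowerLinear_eq]
    exact ((N.realPowerLinear.map_add _ _).trans
      (congrArg₂ _ (N.realPowerLinear.map_smul s A) (N.realPowerLinear.map_smul t B))).symm

theorem injectionRegion_subset_relaxedRegion {Vlo Vhi : V → ℝ} (hV : ∀ i, 0 ≤ Vlo i) :
    N.injectionRegion Vlo Vhi ⊆ N.relaxedRegion Vlo Vhi := by
  rintro _ ⟨v, hv, rfl⟩
  refine ⟨_, Matrix.posSemidef_vecMulVec_self_star v, fun i => ?_, rfl⟩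
  have : (Matrix.vecMulVec v (star v) i i).re = ‖v i‖ ^ 2 := by
    rw [Matrix.vecMulVec_apply, Pi.star_apply, Complex.star_def, Complex.mul_conj,
      Complex.ofReal_re, Complex.normSq_eq_norm_sq]
  rw [this]
  exact ⟨pow_le_pow_left₀ (hV i) (hv i).1 2, pow_le_pow_left₀ (norm_nonneg _) (hv i).2 2⟩

theorem relaxedRegion_subset_convexHull (hN : N.graph.IsRankOneConvex) {Vlo Vhi : V → ℝ}
    (hV : ∀ i, 0 ≤ Vhi i) :
    N.relaxedRegion Vlo Vhi ⊆ convexHull ℝ (N.injectionRegion Vlo Vhi) := by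
  rintro _ ⟨W, hW, hWd, rfl⟩
  have h := Set.mem_image_of_mem N.realPowerLinear (hN W hW)
  rw [LinearMap.image_convexHull] at h
  refine convexHull_mono ?_ (Set.mem_of_eq_of_mem
    ((N.realPowerLinear_mask W).trans (N.realPowerLinear_eq W)).symm h)
  rintro _ ⟨_, ⟨v, hv, rfl⟩, rfl⟩
  refine ⟨v, fun i => ⟨?_, ?_⟩, ?_⟩
  · exact le_of_sq_le_sq ((hWd i).1.trans_eq (hv i).symm) (norm_nonneg _)
  · exact le_of_sq_le_sq ((hv i).trans_le (hWd i).2) (hV i)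
  · rw [realPowerLinear_mask, ← realPowerLinear_eq]
    rfl

end Network

theorem theorem4 :
    (∀ (V : Type u) [Fintype V] (N : Network V), N.IsCycleTreeConnection →
      ∀ Vlo Vhi : V → ℝ, (∀ i, 0 ≤ Vlo i ∧ Vlo i ≤ Vhi i) →
        convexHull ℝ (N.injectionRegion Vlo Vhi) = N.relaxedRegion Vlo Vhi) ∧
    (∀ (U V W : Type u) [Fintype U] [Fintype V] [Fintype W]
      (G : Network U) (H : Network V) (K : Network W), Network.IsOneConnection G H K →
        G.HasRankBound → H.HasRankBound → K.HasRankBound) := by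
  refine ⟨fun V _ N hN Vlo Vhi hV => ?_, fun U V W _ _ _ G H K hK hG hH => hG.oneConnection hK hH⟩
  apply Set.Subset.antisymm
  · exact convexHull_min (N.injectionRegion_subset_relaxedRegion fun i => (hV i).1)
      (N.convex_relaxedRegion Vlo Vhi)
  · exact N.relaxedRegion_subset_convexHull hN.isRankOneConvex fun i => (hV i).1.trans (hV i).2
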